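/- **Notation.** Identify $\mathbb R^2\simeq\mathbb C$. Let $\Phi:\mathbb C\cup\{\infty\}\to\mathbb S^2$, $\Phi(z)=\big(\tfrac{2z}{1+|z|^2},\tfrac{|z|^2-1}{1+|z|^2}\big)$, $\Phi(\infty)=\mathbf e_3$, be the inverse stereographic projection, let $w_*(z)=i\,\frac{z-1}{z+1}$ (so $w_*(-1)=\infty$), and let $R_{\mathbf e,\theta}$ denote the rotation of $\mathbb R^3$ of axis $\mathbf e$ and angle $\theta$. For $z_0\in\mathbb C$, $\rho>0$, $\phi,\alpha,\beta\in\mathbb R$ define the Möbius map $$\boldsymbol m^{\{z_0,\rho,\phi,\alpha,\beta\}}(x)=R_{\mathbf e_3,\phi}\,\boldsymbol m^{[\alpha,\beta]}\Big(e^{-i\phi}\,\frac{x-z_0}{\rho}\Big),\qquad \boldsymbol m^{[\alpha,\beta]}(z)=R_{\mathbf e_1,2\beta}\,\Phi\big(w_*(e^{-i\alpha}z)\big).$$ Let $\mathcal W_{-1}$ be the set of measurable maps $\boldsymbol m\in H^1_{\rm loc}(\mathbb R^2;\mathbb S^2)$ with $\int_{\mathbb R^2}|\nabla\boldsymbol m|^2dx<\infty$,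 $A(\boldsymbol m)=\int_{\mathbb R^2}m_3^2\,dx<\infty$ and degree $Q(\boldsymbol m)=\frac1{4\pi}\int_{\mathbb R^2}\boldsymbol m\cdot(\partial_1\boldsymbol m\times\partial_2\boldsymbol m)\,dx=-1$. For $\boldsymbol m\in\mathcal W_{-1}$ set $L=\big(\int_{\mathbb R^2}|\nabla\boldsymbol m|^2dx-8\pi\big)^{-1/2}$. **Statement.** Let $c_*,c_{\rm MT}>0$. There exist $L_0,C>0$, depending only on $c_*$ and $c_{\rm MT}$, such that the following holds. Let $\boldsymbol m\in\mathcal W_{-1}$ satisfy $L\ge L_0$, and let $z_0\in\mathbb C$, $\rho>0$, $\phi,\alpha,\beta\in\mathbb R$ be such that $\Psi=\boldsymbol m^{\{z_0,\rho,\phi,\alpha,\beta\}}$ and $\boldsymbol v=\boldsymbol m-\Psi$ satisfy $$\int_{\mathbb R^2}|\nabla\boldsymbol v|^2\,dx\le\frac{c_*}{L^2}\qquad\text{and}\qquad\int_{\mathbb R^2}\exp\bigg(\frac{v_3^2}{\int_{\mathbb R^2}|\nabla v_3|^2dx}\bigg)|\nabla\Psi|^2\,dx\le c_{\rm MT}.$$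 Then $$\frac{A(\boldsymbol m)}{\rho^2}\ge\frac1C\sin^2(2\beta)\,L^2,\qquad \frac{A(\boldsymbol m)}{\rho^2}\ge4\pi\cos^2(2\beta)\ln L-C,\qquad\text{and}\qquad \frac{A(\boldsymbol m)}{\rho^2}\ge4\pi\ln L-C.$$ -/

import Mathlib

open MeasureTheory
open scoped ENNReal Matrix

noncomputable section

namespace Bimeron

/-- The ambient space `ℝ³` with its Euclidean norm. The plane `ℝ²` is identified with `ℂ`. -/
abbrev R3 : Type := EuclideanSpace ℝ (Fin 3)

/-! ### Weak derivatives on the plane -/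

section Weak

variable {F : Type*} [NormedAddCommGroup F] [NormedSpace ℝ F]

/-- `g` is the weak (distributional) derivative of `u` on the plane in the direction `e`:
both are locally integrable and `∫ (∂ₑ φ) u = - ∫ φ g` for all test functions `φ ∈ C_c^∞`. -/
structure HasWeakPartial (e : ℂ) (u g : ℂ → F) : Prop where
  locInt : LocallyIntegrable u volume
  locInt_deriv : LocallyIntegrable g volume
  integral_eq : ∀ φ : ℂ → ℝ, ContDiff ℝ ((⊤ : ℕ∞) : WithTop ℕ∞) φ → HasCompactSupport φ →
    ∫ x, (fderiv ℝ φ x e) • u x = - ∫ x, φ x • g x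

open Classical in
/-- A representative of the weak derivative of `u` in the direction `e`
(unique up to null sets; it is set to zero if `u` has no weak derivative). -/
def weakPartial (e : ℂ) (u : ℂ → F) : ℂ → F :=
  if h : ∃ g, HasWeakPartial e u g then h.choose else 0

/-- The squared norm `|∇u|² = |∂₁u|² + |∂₂u|²` of the weak gradient. -/
def gradSq (u : ℂ → F) (x : ℂ) : ℝ≥0∞ :=
  ‖weakPartial 1 u x‖ₑ ^ 2 + ‖weakPartial Complex.I u x‖ₑ ^ 2

/-- The integral `∫_{ℝ²} |∇u|² dx`, as an element of `[0, ∞]`. -/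
def gradEnergy (u : ℂ → F) : ℝ≥0∞ := ∫⁻ x, gradSq u x

end Weak

/-! ### Maps into the sphere, anisotropy and degree -/

/-- The homogeneous Sobolev space `𝓗(ℝ²; 𝕊²)`: measurable maps with values in the unit sphere
that are weakly differentiable with square integrable weak gradient. -/
structure MemH (m : ℂ → R3) : Prop where
  aestronglyMeasurable : AEStronglyMeasurable m volume
  norm_eq_one : ∀ᵐ x, ‖m x‖ = 1
  hasWeakPartial_one : ∃ g, HasWeakPartial 1 m g
  hasWeakPartial_I : ∃ g, HasWeakPartial Complex.I m g
  gradEnergy_lt_top : gradEnergy m < ∞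

/-- The easy-plane anisotropy `A(m) = ∫_{ℝ²} m₃² dx`, as an element of `[0, ∞]`. -/
def anisotropy (m : ℂ → R3) : ℝ≥0∞ := ∫⁻ x, ENNReal.ofReal ((m x 2) ^ 2)

/-- The topological degree `Q(m) = (1 / 4π) ∫_{ℝ²} m · (∂₁m × ∂₂m) dx`. -/
def degree (m : ℂ → R3) : ℝ :=
  1 / (4 * Real.pi) * ∫ x, (m x).ofLp ⬝ᵥ
    ((weakPartial 1 m x).ofLp ⨯₃ (weakPartial Complex.I m x).ofLp)

/-- The class `𝓦_q` of maps `m ∈ 𝓗(ℝ²; 𝕊²)` with `A(m) < ∞` and `Q(m) = q`. -/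
structure MemW (q : ℤ) (m : ℂ → R3) : Prop where
  memH : MemH m
  anisotropy_lt_top : anisotropy m < ∞
  degree_eq : degree m = q

/-- The parameter `L = (∫_{ℝ²} |∇m|² dx - 8π)^{-1/2}`. -/
def scaleL (m : ℂ → R3) : ℝ := ((gradEnergy m).toReal - 8 * Real.pi) ^ (-(1 / 2) : ℝ)

/-! ### Möbius maps -/

/-- The inverse stereographic projection `Φ : ℂ ∪ {∞} → 𝕊²`,
`Φ(z) = (2z / (1 + |z|²), (|z|² - 1) / (1 + |z|²))`, `Φ(∞) = e₃`. -/
def stereo (w : OnePoint ℂ) : R3 :=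
  w.elim !₂[0, 0, 1] fun z =>
    !₂[2 * z.re / (1 + ‖z‖ ^ 2), 2 * z.im / (1 + ‖z‖ ^ 2), (‖z‖ ^ 2 - 1) / (1 + ‖z‖ ^ 2)]

/-- The Möbius transformation `w_*(z) = i (z - 1) / (z + 1)`, with its pole at `z = -1`. -/
def wStar (z : ℂ) : OnePoint ℂ :=
  if z = -1 then OnePoint.infty else ((Complex.I * (z - 1) / (z + 1) : ℂ) : OnePoint ℂ)

/-- The rotation of axis `e₁` and angle `θ` in `ℝ³`. -/
def rotE1 (θ : ℝ) (y : R3) : R3 :=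
  !₂[y 0, Real.cos θ * y 1 - Real.sin θ * y 2, Real.sin θ * y 1 + Real.cos θ * y 2]

/-- The rotation of axis `e₃` and angle `θ` in `ℝ³`. -/
def rotE3 (θ : ℝ) (y : R3) : R3 :=
  !₂[Real.cos θ * y 0 - Real.sin θ * y 1, Real.sin θ * y 0 + Real.cos θ * y 1, y 2]

/-- Translation: `𝔗_{z₀} m (x) = m (x - z₀)`. -/
def translation (z₀ : ℂ) (m : ℂ → R3) : ℂ → R3 := fun x => m (x - z₀)

/-- Dilation: `𝔇_ρ m (x) = m (x / ρ)`. -/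
def dilation (ρ : ℝ) (m : ℂ → R3) : ℂ → R3 := fun x => m (x / (ρ : ℂ))

/-- Corotation: `ℜ_φ m (x) = R_{e₃, φ} m (e^{-iφ} x)`. -/
def corotation (φ : ℝ) (m : ℂ → R3) : ℂ → R3 :=
  fun x => rotE3 φ (m (Complex.exp (-(Complex.I * φ)) * x))

/-- `m^{[α,β]}(z) = R_{e₁, 2β} Φ(w_*(e^{-iα} z))`. -/
def mobiusBase (α β : ℝ) : ℂ → R3 :=
  fun z => rotE1 (2 * β) (stereo (wStar (Complex.exp (-(Complex.I * α)) * z)))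

/-- The Möbius map `m^{z₀,ρ,φ,α,β} = 𝔗_{z₀} 𝔇_ρ ℜ_φ m^{[α,β]}`. -/
def mobiusMap (z₀ : ℂ) (ρ φ α β : ℝ) : ℂ → R3 :=
  translation z₀ (dilation ρ (corotation φ (mobiusBase α β)))

/-- The integral `∫_{ℝ²} exp (f² / ∫ |∇f|²) |∇Ψ|² dx` of Moser–Trudinger type, in `[0, ∞]`.
The quotient is taken in `[0, ∞]`, so `c / 0 = ∞` for `c > 0`, and `exp ∞ = ∞`. -/
def moserTrudingerIntegral (f : ℂ → ℝ) (Ψ : ℂ → R3) : ℝ≥0∞ :=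
  ∫⁻ x, EReal.exp ((ENNReal.ofReal (f x ^ 2) / gradEnergy f : ℝ≥0∞) : EReal) * gradSq Ψ x

end Bimeron

end

noncomputable section

namespace Bimeron

/-! ### Weak derivatives: uniqueness, linearity, coordinates -/

section Weak

variable {F : Type*} [NormedAddCommGroup F] [NormedSpace ℝ F]

/-! Write `s = sin 2β`, `c = cos 2β`. After the affine change of variables of the Möbius map, `Ψ₃`
is `profile s c = s * vert - c * horiz`. Here `vert` tends to 1 at infinity, so its square integral
over a disc of radius `L` grows like `L²`. `horiz` decays like `1/|z|`, and its square integral is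
`4π log L + O(1)`. The two are orthogonal on discs because one is even and the other odd. It remains
to control the perturbation `f = v₃` in `m₃ = Ψ₃ + f`.

Logarithmic bound (`MemW.log_le_anisotropy`). A crude estimate of `f` would lose the sharp constant
`4π`. Instead use `m₃² ≥ 2 m₃ g - g²` with `g = -c * G`, where `G` is `horiz` cut off at scale `L`.
The only error is then the linear term `∫ G f`. As `G` is the angular derivative of `swirl`,
integration by parts trades `f` for `∇f`, and `∫ |∇f|² ≤ cStar / L²` makes this error `O(ρ²)`
(`abs_integral_mul_horiz_le`).

Quadratic bound (`MemW.sq_le_anisotropy_add_log`). On the disc of radius `ρL` use `m₃² ≥ Ψ₃²/2 -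
f²`. The Moser–Trudinger hypothesis gives `∫ f² = O(ρ² log L)` there (`lintegral_ball_sq_le`), so
`A/ρ² ≥ s² L²/2 - O(log L)`.

Combination (`bounds_of_quadratic_of_log`). If `s² ≤ 1/2`, the logarithmic bound absorbs the `log L`
error; otherwise `s² L²` does. For the last inequality, either `A/ρ²` already exceeds `4π log L`, or
the first inequality forces `s² log L = O(1)`, and replacing `c²` by 1 costs only a constant. -/

lemma hasWeakPartial_weakPartial {e : ℂ} {u : ℂ → F} (h : ∃ g, HasWeakPartial e u g) :
    HasWeakPartial e u (weakPartial e u) := by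
  rw [weakPartial, dif_pos h]
  exact h.choose_spec

/-- Weak derivatives are unique up to null sets. -/
lemma HasWeakPartial.ae_eq [CompleteSpace F] {e : ℂ} {u g g' : ℂ → F}
    (h : HasWeakPartial e u g) (h' : HasWeakPartial e u g') : g =ᵐ[volume] g' := by
  refine ae_eq_of_integral_contDiff_smul_eq h.locInt_deriv h'.locInt_deriv fun φ hφ hc => ?_
  have h1 := h.integral_eq φ hφ hc
  rw [h'.integral_eq φ hφ hc] at h1
  exact (neg_injective h1).symm

lemma HasWeakPartial.weakPartial_ae_eq [CompleteSpace F] {e : ℂ} {u g : ℂ → F}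
    (h : HasWeakPartial e u g) : weakPartial e u =ᵐ[volume] g :=
  (hasWeakPartial_weakPartial ⟨g, h⟩).ae_eq h

lemma continuous_fderiv_apply_of_contDiff {φ : ℂ → F}
    (hφ : ContDiff ℝ ((⊤ : ℕ∞) : WithTop ℕ∞) φ) (e : ℂ) : Continuous fun x => fderiv ℝ φ x e :=
  (hφ.continuous_fderiv (by simp)).clm_apply continuous_const

lemma hasCompactSupport_fderiv_apply {φ : ℂ → F} (hc : HasCompactSupport φ) (e : ℂ) :
    HasCompactSupport fun x => fderiv ℝ φ x e :=
  hc.fderiv_apply ℝ e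

lemma HasWeakPartial.sub {e : ℂ} {u u' g g' : ℂ → F}
    (h : HasWeakPartial e u g) (h' : HasWeakPartial e u' g') :
    HasWeakPartial e (fun x => u x - u' x) (fun x => g x - g' x) where
  locInt := h.locInt.sub h'.locInt
  locInt_deriv := h.locInt_deriv.sub h'.locInt_deriv
  integral_eq φ hφ hc := by
    have hc' := hasCompactSupport_fderiv_apply hc e
    have hd := continuous_fderiv_apply_of_contDiff hφ e
    simp only [smul_sub]
    rw [integral_sub (h.locInt.integrable_smul_left_of_hasCompactSupport hd hc')
        (h'.locInt.integrable_smul_left_of_hasCompactSupport hd hc'),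
      integral_sub (h.locInt_deriv.integrable_smul_left_of_hasCompactSupport hφ.continuous hc)
        (h'.locInt_deriv.integrable_smul_left_of_hasCompactSupport hφ.continuous hc),
      h.integral_eq φ hφ hc, h'.integral_eq φ hφ hc]
    abel

lemma _root_.MeasureTheory.LocallyIntegrable.clm_comp {G : Type*} [NormedAddCommGroup G]
    [NormedSpace ℝ G] {u : ℂ → F} (hu : LocallyIntegrable u volume) (T : F →L[ℝ] G) :
    LocallyIntegrable (fun x => T (u x)) volume := fun x => by
  obtain ⟨s, hs, hi⟩ := hu x
  exact ⟨s, hs, T.integrable_comp hi⟩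

lemma HasWeakPartial.clm_comp {G : Type*} [NormedAddCommGroup G] [NormedSpace ℝ G]
    [CompleteSpace F] [CompleteSpace G] {e : ℂ} {u g : ℂ → F} (h : HasWeakPartial e u g)
    (T : F →L[ℝ] G) : HasWeakPartial e (fun x => T (u x)) (fun x => T (g x)) where
  locInt := h.locInt.clm_comp T
  locInt_deriv := h.locInt_deriv.clm_comp T
  integral_eq φ hφ hc := by
    have hc' := hasCompactSupport_fderiv_apply hc e
    have hd := continuous_fderiv_apply_of_contDiff hφ e
    simp only [← map_smul]
    rw [T.integral_comp_comm (h.locInt.integrable_smul_left_of_hasCompactSupport hd hc'),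
      T.integral_comp_comm
        (h.locInt_deriv.integrable_smul_left_of_hasCompactSupport hφ.continuous hc),
      h.integral_eq φ hφ hc, map_neg]

/-- Smooth functions are weakly differentiable. -/
lemma hasWeakPartial_of_contDiff {u : ℂ → F}
    (hu : ContDiff ℝ ((⊤ : ℕ∞) : WithTop ℕ∞) u) (e : ℂ) :
    HasWeakPartial e u fun x => fderiv ℝ u x e where
  locInt := hu.continuous.locallyIntegrable
  locInt_deriv := (continuous_fderiv_apply_of_contDiff hu e).locallyIntegrable
  integral_eq φ hφ hc := by
    have hc' := hasCompactSupport_fderiv_apply hc e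
    have hd := continuous_fderiv_apply_of_contDiff hφ e
    have hd' := continuous_fderiv_apply_of_contDiff hu e
    rw [eq_comm, neg_eq_iff_eq_neg]
    exact integral_smul_fderiv_eq_neg_fderiv_smul_of_integrable
      (hu.continuous.locallyIntegrable.integrable_smul_left_of_hasCompactSupport hd hc')
      (hd'.locallyIntegrable.integrable_smul_left_of_hasCompactSupport hφ.continuous hc)
      (hu.continuous.locallyIntegrable.integrable_smul_left_of_hasCompactSupport hφ.continuous hc)
      (fun x _ => hφ.differentiable (by simp) x) (fun x _ => hu.differentiable (by simp) x)

/-- The gradient energy of a coordinate is at most that of the map. -/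
lemma gradEnergy_coord_le {v : ℂ → R3} (h1 : ∃ g, HasWeakPartial 1 v g)
    (hI : ∃ g, HasWeakPartial Complex.I v g) (i : Fin 3) :
    gradEnergy (fun x => v x i) ≤ gradEnergy v := by
  have key : ∀ e : ℂ, (∃ g, HasWeakPartial e v g) →
      ∀ᵐ x, ‖weakPartial e (fun x => v x i) x‖ₑ ^ 2 ≤ ‖weakPartial e v x‖ₑ ^ 2 := by
    intro e he
    have h := ((hasWeakPartial_weakPartial he).clm_comp
      (EuclideanSpace.proj (𝕜 := ℝ) i)).weakPartial_ae_eq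
    filter_upwards [h] with x hx
    have hx' : weakPartial e (fun x => v x i) x = weakPartial e v x i := hx
    rw [hx']
    gcongr
    rw [← ofReal_norm, ← ofReal_norm]
    exact ENNReal.ofReal_le_ofReal (PiLp.norm_apply_le _ i)
  refine lintegral_mono_ae ?_
  filter_upwards [key 1 h1, key _ hI] with x a b
  exact add_le_add a b

end Weak

/-! ### Möbius maps: closed form, third component, energy density -/

section Mobius

/-- The map `Φ ∘ w_*` in closed form. -/
def bubble (z : ℂ) : R3 :=
  !₂[-(2 * z.im) / (1 + Complex.normSq z), (Complex.normSq z - 1) / (1 + Complex.normSq z),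
    -(2 * z.re) / (1 + Complex.normSq z)]

lemma one_add_normSq_pos (z : ℂ) : 0 < 1 + Complex.normSq z := by
  linarith [Complex.normSq_nonneg z]

/-- The factors `|z + 1|²` cancel between numerators and denominators, so the pole at `-1` leaves no
trace and smoothness can be read off. -/
lemma stereo_wStar (z : ℂ) : stereo (wStar z) = bubble z := by
  have hz := (one_add_normSq_pos z).ne'
  by_cases h : z = -1
  · subst h
    ext i
    fin_cases i <;> (simp [stereo, wStar, bubble]; try norm_num)
  · have h' : z + 1 ≠ 0 := fun h0 => h (eq_neg_of_add_eq_zero_left h0)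
    have hn : Complex.normSq (z + 1) ≠ 0 := by simpa using h'
    have hw : Complex.I * (z - 1) / (z + 1) =
        ((-(2 * z.im) / Complex.normSq (z + 1) : ℝ) : ℂ)
          + ((Complex.normSq z - 1) / Complex.normSq (z + 1) : ℝ) * Complex.I := by
      have hc : ((Complex.normSq (z + 1) : ℝ) : ℂ) ≠ 0 := by exact_mod_cast hn
      rw [div_eq_iff h']
      push_cast
      field_simp
      apply Complex.ext <;> simp [Complex.normSq_apply] <;> ring
    have hns : 1 + ‖Complex.I * (z - 1) / (z + 1)‖ ^ 2
        = 2 * (1 + Complex.normSq z) / Complex.normSq (z + 1) := by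
      rw [← Complex.normSq_eq_norm_sq, map_div₀, map_mul, Complex.normSq_I]
      field_simp
      simp [Complex.normSq_apply]
      ring
    have hns' : ‖Complex.I * (z - 1) / (z + 1)‖ ^ 2 - 1
        = -4 * z.re / Complex.normSq (z + 1) := by
      rw [← Complex.normSq_eq_norm_sq, map_div₀, map_mul, Complex.normSq_I]
      field_simp
      simp [Complex.normSq_apply]
      ring
    have hre : (Complex.I * (z - 1) / (z + 1)).re = -(2 * z.im) / Complex.normSq (z + 1) := by
      rw [hw]
      simp [-Complex.ofReal_div]
    have him : (Complex.I * (z - 1) / (z + 1)).im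
        = (Complex.normSq z - 1) / Complex.normSq (z + 1) := by
      rw [hw]
      simp [-Complex.ofReal_div]
    have hs : stereo (wStar z) = !₂[2 * (Complex.I * (z - 1) / (z + 1)).re
          / (1 + ‖Complex.I * (z - 1) / (z + 1)‖ ^ 2),
        2 * (Complex.I * (z - 1) / (z + 1)).im / (1 + ‖Complex.I * (z - 1) / (z + 1)‖ ^ 2),
        (‖Complex.I * (z - 1) / (z + 1)‖ ^ 2 - 1)
          / (1 + ‖Complex.I * (z - 1) / (z + 1)‖ ^ 2)] := by
      rw [wStar, if_neg h]
      rfl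
    rw [hs, hns, hns', hre, him, bubble]
    ext i
    fin_cases i
    · simp
      field_simp
    · simp
      field_simp
    · simp
      field_simp
      ring

/-- The linear factor of the affine change of variables in a Möbius map. -/
def dilRot (ρ φ α : ℝ) : ℂ :=
  Complex.exp (-(Complex.I * α)) * (Complex.exp (-(Complex.I * φ)) * (ρ : ℂ)⁻¹)

lemma norm_dilRot {ρ : ℝ} (hρ : 0 < ρ) (φ α : ℝ) : ‖dilRot ρ φ α‖ = ρ⁻¹ := by
  have h : ∀ t : ℝ, ‖Complex.exp (-(Complex.I * t))‖ = 1 := fun t => by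
    have := Complex.norm_exp_ofReal_mul_I (-t)
    rw [← this]
    congr 2
    push_cast
    ring
  rw [dilRot, norm_mul, norm_mul, h, h, norm_inv, Complex.norm_real, Real.norm_of_nonneg hρ.le]
  ring

lemma normSq_dilRot_mul {ρ : ℝ} (hρ : 0 < ρ) (φ α : ℝ) (u : ℂ) :
    Complex.normSq (dilRot ρ φ α * u) = Complex.normSq u / ρ ^ 2 := by
  rw [Complex.normSq_mul, Complex.normSq_eq_norm_sq (dilRot ρ φ α), norm_dilRot hρ]
  field_simp

lemma mobiusMap_eq (z₀ : ℂ) (ρ φ α β : ℝ) (x : ℂ) :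
    mobiusMap z₀ ρ φ α β x = rotE3 φ (rotE1 (2 * β) (bubble (dilRot ρ φ α * (x - z₀)))) := by
  simp only [mobiusMap, translation, dilation, corotation, mobiusBase, stereo_wStar, dilRot]
  congr 3
  ring

lemma mobiusMap_two (z₀ : ℂ) (ρ φ α β : ℝ) (x : ℂ) :
    mobiusMap z₀ ρ φ α β x 2 =
      Real.sin (2 * β) * ((Complex.normSq (dilRot ρ φ α * (x - z₀)) - 1)
        / (1 + Complex.normSq (dilRot ρ φ α * (x - z₀))))
      - Real.cos (2 * β) * (2 * (dilRot ρ φ α * (x - z₀)).re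
        / (1 + Complex.normSq (dilRot ρ φ α * (x - z₀)))) := by
  rw [mobiusMap_eq]
  simp [rotE3, rotE1, bubble]
  ring

lemma norm_rotE1_sub (θ : ℝ) (a b : R3) : ‖rotE1 θ a - rotE1 θ b‖ ^ 2 = ‖a - b‖ ^ 2 := by
  rw [EuclideanSpace.real_norm_sq_eq, EuclideanSpace.real_norm_sq_eq]
  simp [rotE1, Fin.sum_univ_three]
  linear_combination ((a 1 - b 1) ^ 2 + (a 2 - b 2) ^ 2) * Real.sin_sq_add_cos_sq θ

lemma norm_rotE3_sub (θ : ℝ) (a b : R3) : ‖rotE3 θ a - rotE3 θ b‖ ^ 2 = ‖a - b‖ ^ 2 := by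
  rw [EuclideanSpace.real_norm_sq_eq, EuclideanSpace.real_norm_sq_eq]
  simp [rotE3, Fin.sum_univ_three]
  linear_combination ((a 0 - b 0) ^ 2 + (a 1 - b 1) ^ 2) * Real.sin_sq_add_cos_sq θ

/-- The chordal distance formula. -/
lemma norm_bubble_sub (z w : ℂ) : ‖bubble z - bubble w‖ ^ 2
    = 4 * Complex.normSq (z - w) / ((1 + Complex.normSq z) * (1 + Complex.normSq w)) := by
  rw [EuclideanSpace.real_norm_sq_eq]
  have h1 := (one_add_normSq_pos z).ne'
  have h2 := (one_add_normSq_pos w).ne'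
  simp [bubble, Fin.sum_univ_three]
  field_simp
  simp only [Complex.normSq_apply, Complex.sub_re, Complex.sub_im]
  ring

lemma norm_mobiusMap_sub {z₀ : ℂ} {ρ φ α β : ℝ} (hρ : 0 < ρ) (x y : ℂ) :
    ‖mobiusMap z₀ ρ φ α β x - mobiusMap z₀ ρ φ α β y‖ ^ 2
    = 4 / ρ ^ 2 * Complex.normSq (x - y) / ((1 + Complex.normSq (x - z₀) / ρ ^ 2)
        * (1 + Complex.normSq (y - z₀) / ρ ^ 2)) := by
  rw [mobiusMap_eq, mobiusMap_eq, norm_rotE3_sub, norm_rotE1_sub, norm_bubble_sub, ← mul_sub,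
    normSq_dilRot_mul hρ, normSq_dilRot_mul hρ, normSq_dilRot_mul hρ, sub_sub_sub_cancel_right]
  ring

lemma contDiff_normSq {n : WithTop ℕ∞} : ContDiff ℝ n Complex.normSq := by
  have : (Complex.normSq : ℂ → ℝ) = fun z => z.re * z.re + z.im * z.im := by
    ext z; rw [Complex.normSq_apply]
  rw [this]
  exact ((Complex.reCLM.contDiff.mul Complex.reCLM.contDiff).add
    (Complex.imCLM.contDiff.mul Complex.imCLM.contDiff))

lemma contDiff_bubble {n : WithTop ℕ∞} : ContDiff ℝ n bubble := by
  have hd : ContDiff ℝ n fun z : ℂ => 1 + Complex.normSq z := contDiff_const.add contDiff_normSq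
  have h0 : ∀ z : ℂ, 1 + Complex.normSq z ≠ 0 := fun z => (one_add_normSq_pos z).ne'
  rw [contDiff_euclidean]
  intro i
  fin_cases i
  · exact ((contDiff_const.mul Complex.imCLM.contDiff).neg).div hd h0
  · exact (contDiff_normSq.sub contDiff_const).div hd h0
  · exact ((contDiff_const.mul Complex.reCLM.contDiff).neg).div hd h0

lemma contDiff_mobiusMap {n : WithTop ℕ∞} (z₀ : ℂ) (ρ φ α β : ℝ) :
    ContDiff ℝ n (mobiusMap z₀ ρ φ α β) := by
  have hb : ContDiff ℝ n fun x : ℂ => bubble (dilRot ρ φ α * (x - z₀)) :=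
    contDiff_bubble.comp (contDiff_const.mul (contDiff_id.sub contDiff_const))
  have hb' := contDiff_euclidean.1 hb
  have : mobiusMap z₀ ρ φ α β = _ := funext (mobiusMap_eq z₀ ρ φ α β)
  rw [this, contDiff_euclidean]
  intro i
  fin_cases i
  · exact (contDiff_const.mul (hb' 0)).sub (contDiff_const.mul
      ((contDiff_const.mul (hb' 1)).sub (contDiff_const.mul (hb' 2))))
  · exact (contDiff_const.mul (hb' 0)).add (contDiff_const.mul
      ((contDiff_const.mul (hb' 1)).sub (contDiff_const.mul (hb' 2))))
  · exact (contDiff_const.mul (hb' 1)).add (contDiff_const.mul (hb' 2))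

open Filter Topology in
-- Infinitesimal form of the chordal distance formula: the squared norm of the difference quotient
-- is explicit, and letting the increment tend to zero avoids differentiating components.
lemma norm_fderiv_mobiusMap {z₀ : ℂ} {ρ φ α β : ℝ} (hρ : 0 < ρ) (x e : ℂ) :
    ‖fderiv ℝ (mobiusMap z₀ ρ φ α β) x e‖ ^ 2
    = 4 / ρ ^ 2 * Complex.normSq e / (1 + Complex.normSq (x - z₀) / ρ ^ 2) ^ 2 := by
  have hd : DifferentiableAt ℝ (mobiusMap z₀ ρ φ α β) x :=
    (contDiff_mobiusMap (n := 1) z₀ ρ φ α β).differentiable (by simp) x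
  have h1 := (hasDerivAt_iff_tendsto_slope_zero.1 (hd.hasFDerivAt.hasLineDerivAt e)).norm.pow 2
  have hpos : ∀ y : ℂ, 0 < 1 + Complex.normSq (y - z₀) / ρ ^ 2 := fun y => by
    have := Complex.normSq_nonneg (y - z₀)
    positivity
  have hc : Continuous fun t : ℝ => 4 / ρ ^ 2 * Complex.normSq e
      / ((1 + Complex.normSq (x + t • e - z₀) / ρ ^ 2)
        * (1 + Complex.normSq (x - z₀) / ρ ^ 2)) := by
    refine continuous_const.div ?_ fun t => (mul_pos (hpos _) (hpos _)).ne'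
    have := Complex.continuous_normSq
    fun_prop
  have h2 := (hc.tendsto 0).mono_left (nhdsWithin_le_nhds (s := {0}ᶜ))
  have h3 := tendsto_nhds_unique h1 (h2.congr' ?_)
  · rw [h3]
    simp [sq]
  · filter_upwards [self_mem_nhdsWithin] with t ht
    have ht' : t ≠ 0 := ht
    rw [norm_smul, mul_pow]
    simp only [zero_add, zero_smul, add_zero]
    rw [norm_mobiusMap_sub hρ, add_sub_cancel_left]
    have : Complex.normSq (t • e) = t ^ 2 * Complex.normSq e := by
      rw [Complex.real_smul, Complex.normSq_mul, Complex.normSq_ofReal, sq]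
    rw [this, norm_inv, inv_pow, Real.norm_eq_abs, sq_abs]
    field_simp

/-- The energy density of a Möbius map. -/
lemma gradSq_mobiusMap {ρ : ℝ} (hρ : 0 < ρ) (z₀ : ℂ) (φ α β : ℝ) :
    ∀ᵐ x, gradSq (mobiusMap z₀ ρ φ α β) x
      = ENNReal.ofReal (8 / ρ ^ 2 / (1 + Complex.normSq (x - z₀) / ρ ^ 2) ^ 2) := by
  have h1 := (hasWeakPartial_of_contDiff (contDiff_mobiusMap z₀ ρ φ α β) 1).weakPartial_ae_eq
  have hI := (hasWeakPartial_of_contDiff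
    (contDiff_mobiusMap z₀ ρ φ α β) Complex.I).weakPartial_ae_eq
  filter_upwards [h1, hI] with x a b
  have hpos : 0 < 1 + Complex.normSq (x - z₀) / ρ ^ 2 := by
    have := Complex.normSq_nonneg (x - z₀)
    positivity
  rw [gradSq, a, b, ← ofReal_norm, ← ofReal_norm, ← ENNReal.ofReal_pow (norm_nonneg _),
    ← ENNReal.ofReal_pow (norm_nonneg _), norm_fderiv_mobiusMap hρ, norm_fderiv_mobiusMap hρ,
    ← ENNReal.ofReal_add (by simp; positivity) (by simp; positivity)]
  congr 1
  simp
  ring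

end Mobius

/-! ### Explicit integrals of the profile -/

section Integrals

open Metric

/-- `dilRot ρ φ α * ρ` has modulus one, so the substitution is a translation, a dilation with
Jacobian `ρ²` and a measure-preserving rotation. -/
lemma integral_comp_dilRot {ρ : ℝ} (hρ : 0 < ρ) (z₀ : ℂ) (φ α : ℝ) (f : ℂ → ℝ) :
    ∫ x, f (dilRot ρ φ α * (x - z₀)) = ρ ^ 2 * ∫ z, f z := by
  have hc : ‖dilRot ρ φ α * ρ‖ = 1 := by
    rw [norm_mul, norm_dilRot hρ, Complex.norm_real, Real.norm_of_nonneg hρ.le,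
      inv_mul_cancel₀ hρ.ne']
  have hρ' : (ρ : ℂ) ≠ 0 := by exact_mod_cast hρ.ne'
  let c : Circle := ⟨dilRot ρ φ α * ρ, by simpa [Submonoid.unitSphere] using hc⟩
  have hr : ∀ z, rotation c z = dilRot ρ φ α * ρ * z := fun z => rotation_apply c z
  have h1 : ∀ x, f (dilRot ρ φ α * x) = (fun y => f (rotation c y)) (ρ⁻¹ • x) := fun x => by
    simp only [hr, Complex.real_smul]
    congr 1
    push_cast
    field_simp
  rw [integral_sub_right_eq_self (fun x => f (dilRot ρ φ α * x)) z₀]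
  simp_rw [h1]
  rw [Measure.integral_comp_smul volume (fun y => f (rotation c y)), Complex.finrank_real_complex,
    (rotation c).measurePreserving.integral_comp
      (rotation c).toHomeomorph.measurableEmbedding]
  rw [abs_of_pos (by positivity), smul_eq_mul, inv_pow, inv_inv]

lemma setIntegral_comp_dilRot {ρ : ℝ} (hρ : 0 < ρ) (z₀ : ℂ) (φ α L : ℝ) (f : ℂ → ℝ) :
    ∫ x in ball z₀ (ρ * L), f (dilRot ρ φ α * (x - z₀)) = ρ ^ 2 * ∫ z in ball 0 L, f z := by
  rw [← integral_indicator measurableSet_ball, ← integral_indicator measurableSet_ball,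
    ← integral_comp_dilRot hρ z₀ φ α]
  congr 1 with x
  simp only [Set.indicator, mem_ball, dist_eq_norm, sub_zero, norm_mul, norm_dilRot hρ,
    inv_mul_lt_iff₀ hρ]

lemma integral_eq_zero_of_odd {f : ℂ → ℝ} (hf : ∀ z, f (-z) = -f z) : ∫ z, f z = 0 := by
  have h := integral_neg_eq_self f volume
  simp_rw [hf, integral_neg] at h
  linarith

lemma setIntegral_ball_eq_zero_of_odd {f : ℂ → ℝ} (hf : ∀ z, f (-z) = -f z) (L : ℝ) :
    ∫ z in ball 0 L, f z = 0 := by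
  rw [← integral_indicator measurableSet_ball]
  refine integral_eq_zero_of_odd fun z => ?_
  by_cases h : ‖z‖ < L <;> simp [Set.indicator, h, hf]

/-- The leading `r` is the polar Jacobian; the primitive comes from `r³/(1+r²)² = r/(1+r²) -
r/(1+r²)²`. -/
lemma hasDerivAt_radial (r : ℝ) :
    HasDerivAt (fun r : ℝ => (Real.log (1 + r ^ 2) + 1 / (1 + r ^ 2)) / 2)
      (r * (r ^ 2 / (1 + r ^ 2) ^ 2)) r := by
  have hp : 0 < 1 + r ^ 2 := by positivity
  have h0 : HasDerivAt (fun r : ℝ => 1 + r ^ 2) (2 * r) r := by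
    simpa using (hasDerivAt_pow 2 r).const_add 1
  have h1 := ((h0.log hp.ne').fun_add (h0.fun_inv hp.ne')).div_const 2
  simp only [one_div]
  refine h1.congr_deriv ?_
  field_simp
  ring

/-- The integral of `|z|² / (1 + |z|²)²` over a disc. -/
lemma integral_ball_radial {L : ℝ} (hL : 0 ≤ L) :
    ∫ z in ball (0 : ℂ) L, Complex.normSq z / (1 + Complex.normSq z) ^ 2
      = Real.pi * (Real.log (1 + L ^ 2) + 1 / (1 + L ^ 2) - 1) := by
  have h1 : ∫ z in ball (0 : ℂ) L, Complex.normSq z / (1 + Complex.normSq z) ^ 2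
      = ∫ z : ℂ, (Set.Iio L).indicator (fun r : ℝ => r ^ 2 / (1 + r ^ 2) ^ 2) ‖z‖ := by
    rw [← integral_indicator measurableSet_ball]
    congr 1 with z
    simp only [Set.indicator, mem_ball, dist_zero_right, Set.mem_Iio, Complex.normSq_eq_norm_sq]
  have h2 : ∫ y in Set.Ioi (0 : ℝ), y ^ (Module.finrank ℝ ℂ - 1) •
        (Set.Iio L).indicator (fun r : ℝ => r ^ 2 / (1 + r ^ 2) ^ 2) y
      = ∫ y in (0 : ℝ)..L, y * (y ^ 2 / (1 + y ^ 2) ^ 2) := by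
    have : ∀ y : ℝ, y ^ (Module.finrank ℝ ℂ - 1) •
        (Set.Iio L).indicator (fun r : ℝ => r ^ 2 / (1 + r ^ 2) ^ 2) y
        = (Set.Iio L).indicator (fun r : ℝ => r * (r ^ 2 / (1 + r ^ 2) ^ 2)) y := fun y => by
      by_cases h : y < L <;> simp [Set.indicator, h, Complex.finrank_real_complex]
    simp_rw [this]
    rw [setIntegral_indicator measurableSet_Iio, Set.Ioi_inter_Iio,
      ← integral_Ioc_eq_integral_Ioo, ← intervalIntegral.integral_of_le hL]
  have h3 : ∫ y in (0 : ℝ)..L, y * (y ^ 2 / (1 + y ^ 2) ^ 2)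
      = (Real.log (1 + L ^ 2) + 1 / (1 + L ^ 2)) / 2 - 1 / 2 := by
    rw [intervalIntegral.integral_eq_sub_of_hasDerivAt (fun r _ => hasDerivAt_radial r)]
    · simp
    · refine Continuous.intervalIntegrable ?_ _ _
      refine continuous_id.mul ((continuous_pow 2).div (by fun_prop) fun r => ?_)
      positivity
  have hv : (volume : Measure ℂ).real (ball 0 1) = Real.pi := by
    simp [Measure.real, Complex.volume_ball]
  rw [h1, integral_fun_norm_addHaar, h2, h3, hv, Complex.finrank_real_complex]
  simp
  ring

lemma continuous_one_add_normSq : Continuous fun z : ℂ => 1 + Complex.normSq z :=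
  continuous_const.add Complex.continuous_normSq

lemma integrableOn_ball_of_continuous {f : ℂ → ℝ} (hf : Continuous f) (z₀ : ℂ) (L : ℝ) :
    IntegrableOn f (ball z₀ L) :=
  (hf.continuousOn.integrableOn_compact (isCompact_closedBall z₀ L)).mono_set
    ball_subset_closedBall

/-- The horizontal profile `2 x / (1 + |z|²)`. -/
def horiz (z : ℂ) : ℝ := 2 * z.re / (1 + Complex.normSq z)

/-- The radial profile `(|z|² - 1) / (1 + |z|²)`. -/
def vert (z : ℂ) : ℝ := (Complex.normSq z - 1) / (1 + Complex.normSq z)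

lemma continuous_horiz : Continuous horiz :=
  (continuous_const.mul Complex.continuous_re).div continuous_one_add_normSq
    fun z => (one_add_normSq_pos z).ne'

lemma continuous_vert : Continuous vert :=
  (Complex.continuous_normSq.sub continuous_const).div continuous_one_add_normSq
    fun z => (one_add_normSq_pos z).ne'

lemma horiz_neg (z : ℂ) : horiz (-z) = -horiz z := by
  simp [horiz, Complex.normSq_neg, neg_div]

lemma vert_neg (z : ℂ) : vert (-z) = vert z := by simp [vert, Complex.normSq_neg]

/-- A quarter turn exchanges real and imaginary parts up to sign, so averaging over it replaces the
integrand by a radial one. -/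
lemma integral_ball_horiz_sq {L : ℝ} (hL : 0 ≤ L) :
    ∫ z in ball (0 : ℂ) L, horiz z ^ 2
      = 2 * Real.pi * (Real.log (1 + L ^ 2) + 1 / (1 + L ^ 2) - 1) := by
  let c : Circle := ⟨Complex.I, by simp [Submonoid.unitSphere]⟩
  have hrot : ∫ z in ball (0 : ℂ) L, horiz z ^ 2
      = ∫ z in ball (0 : ℂ) L, horiz (Complex.I * z) ^ 2 := by
    rw [← integral_indicator measurableSet_ball, ← integral_indicator measurableSet_ball,
      ← (rotation c).measurePreserving.integral_comp
      (rotation c).toHomeomorph.measurableEmbedding]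
    congr 1 with z
    have hr : rotation c z = Complex.I * z := rotation_apply c z
    simp [Set.indicator, hr]
  have hadd : ∫ z in ball (0 : ℂ) L, (horiz z ^ 2 + horiz (Complex.I * z) ^ 2)
      = 4 * ∫ z in ball (0 : ℂ) L, Complex.normSq z / (1 + Complex.normSq z) ^ 2 := by
    rw [← integral_const_mul]
    congr 1 with z
    have := (one_add_normSq_pos z).ne'
    simp only [horiz, Complex.normSq_mul, Complex.normSq_I, one_mul, Complex.I_mul_re]
    rw [div_pow, div_pow, ← add_div, mul_div_assoc']
    congr 1
    rw [Complex.normSq_apply]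
    ring
  have hch := continuous_horiz
  rw [integral_add (integrableOn_ball_of_continuous (by fun_prop) _ _)
    (integrableOn_ball_of_continuous (by fun_prop) _ _),
    ← hrot, integral_ball_radial hL] at hadd
  linarith

lemma vert_sq (z : ℂ) : vert z ^ 2 = 1 - 4 * (Complex.normSq z / (1 + Complex.normSq z) ^ 2) := by
  have := (one_add_normSq_pos z).ne'
  rw [vert]
  field_simp
  ring

lemma le_integral_ball_vert_sq {L : ℝ} (hL : 5 ≤ L) :
    L ^ 2 ≤ ∫ z in ball (0 : ℂ) L, vert z ^ 2 := by
  have hc : Continuous fun z : ℂ => 4 * (Complex.normSq z / (1 + Complex.normSq z) ^ 2) :=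
    continuous_const.mul (Complex.continuous_normSq.div (continuous_one_add_normSq.pow 2)
      fun z => (pow_pos (one_add_normSq_pos z) 2).ne')
  simp_rw [vert_sq]
  rw [integral_sub (integrableOn_ball_of_continuous continuous_const _ _)
    (integrableOn_ball_of_continuous hc _ _), integral_const_mul,
    integral_ball_radial (by linarith)]
  have hv : ∫ _ in ball (0 : ℂ) L, (1 : ℝ) = L ^ 2 * Real.pi := by
    have : 0 ≤ L := by linarith
    simp [Measure.real, Complex.volume_ball, ENNReal.toReal_ofReal this]
  rw [hv]
  -- The tangent to `log` at 16 bounds the logarithm by a multiple of `L²` small enough to leave a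
  -- full `L²` once `L ≥ 5`.
  have h16 : Real.log 16 ≤ 2.8 := by
    have : (16 : ℝ) = 2 ^ 4 := by norm_num
    rw [this, Real.log_pow]
    have := Real.log_two_lt_d9
    push_cast
    linarith
  have hlog : Real.log (1 + L ^ 2) ≤ (1 + L ^ 2) / 16 - 1 + 2.8 := by
    have h := Real.log_le_sub_one_of_pos (x := (1 + L ^ 2) / 16) (by positivity)
    rw [Real.log_div (by positivity) (by norm_num)] at h
    linarith
  have hinv : 1 / (1 + L ^ 2) ≤ 1 := by
    rw [div_le_one (by positivity)]
    nlinarith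
  have hL2 : 25 ≤ L ^ 2 := by nlinarith
  have hpi := Real.pi_gt_three
  have : Real.log (1 + L ^ 2) + 1 / (1 + L ^ 2) - 1 ≤ L ^ 2 / 16 + 1.87 := by linarith
  nlinarith

/-- The third component of a Möbius map, up to an affine change of variables. -/
def profile (s c : ℝ) (z : ℂ) : ℝ := s * vert z - c * horiz z

lemma continuous_profile (s c : ℝ) : Continuous (profile s c) :=
  (continuous_const.mul continuous_vert).sub (continuous_const.mul continuous_horiz)

lemma le_integral_ball_profile_sq (s c : ℝ) {L : ℝ} (hL : 5 ≤ L) :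
    s ^ 2 * L ^ 2 ≤ ∫ z in ball (0 : ℂ) L, profile s c z ^ 2 := by
  have hcv := continuous_vert
  have hch := continuous_horiz
  have h : ∀ z, profile s c z ^ 2 =
      (s ^ 2 * vert z ^ 2 + c ^ 2 * horiz z ^ 2) - (2 * s * c) * (vert z * horiz z) := fun z => by
    rw [profile]; ring
  simp_rw [h]
  rw [integral_sub (integrableOn_ball_of_continuous (by fun_prop) _ _)
    (integrableOn_ball_of_continuous (by fun_prop) _ _),
    integral_add (integrableOn_ball_of_continuous (by fun_prop) _ _)
    (integrableOn_ball_of_continuous (by fun_prop) _ _), integral_const_mul, integral_const_mul,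
    integral_const_mul, setIntegral_ball_eq_zero_of_odd (f := fun z => vert z * horiz z)
      (fun z => by rw [vert_neg, horiz_neg]; ring)]
  have h1 := le_integral_ball_vert_sq hL
  have h2 : 0 ≤ ∫ z in ball (0 : ℂ) L, horiz z ^ 2 := integral_nonneg fun z => sq_nonneg _
  have := mul_le_mul_of_nonneg_left h1 (sq_nonneg s)
  have := mul_nonneg (sq_nonneg c) h2
  linarith

/-- A smooth radial cutoff function at scale `L`. -/
def cutoff (L : ℝ) (z : ℂ) : ℝ := Real.smoothTransition (2 - Complex.normSq z / L ^ 2)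

lemma contDiff_cutoff (L : ℝ) : ContDiff ℝ ((⊤ : ℕ∞) : WithTop ℕ∞) (cutoff L) :=
  Real.smoothTransition.contDiff.comp
    (contDiff_const.sub (contDiff_normSq.div_const _))

lemma cutoff_eq_one {L : ℝ} (hL : 0 < L) {z : ℂ} (hz : ‖z‖ ≤ L) : cutoff L z = 1 := by
  apply Real.smoothTransition.one_of_one_le
  have : Complex.normSq z / L ^ 2 ≤ 1 := by
    rw [Complex.normSq_eq_norm_sq, div_le_one (by positivity)]
    gcongr
  linarith

lemma cutoff_eq_zero {L : ℝ} (hL : 0 < L) {z : ℂ} (hz : 2 * L ≤ ‖z‖) : cutoff L z = 0 := by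
  apply Real.smoothTransition.zero_of_nonpos
  have : 2 ≤ Complex.normSq z / L ^ 2 := by
    rw [Complex.normSq_eq_norm_sq, le_div_iff₀ (by positivity)]
    nlinarith
  linarith

lemma cutoff_nonneg (L : ℝ) (z : ℂ) : 0 ≤ cutoff L z := Real.smoothTransition.nonneg _

lemma cutoff_le_one (L : ℝ) (z : ℂ) : cutoff L z ≤ 1 := Real.smoothTransition.le_one _

lemma hasCompactSupport_cutoff {L : ℝ} (hL : 0 < L) : HasCompactSupport (cutoff L) :=
  HasCompactSupport.intro (isCompact_closedBall 0 (2 * L)) fun z hz =>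
    cutoff_eq_zero hL (by simpa using (not_le.1 (by simpa using hz)).le)

lemma cutoff_neg (L : ℝ) (z : ℂ) : cutoff L (-z) = cutoff L z := by
  simp [cutoff, Complex.normSq_neg]

/-- Testing the profile against its truncated horizontal part. -/
lemma le_integral_profile_test (s c : ℝ) {L : ℝ} (hL : 1 ≤ L) :
    c ^ 2 * (4 * Real.pi * Real.log L - 2 * Real.pi) ≤
      ∫ z, (2 * profile s c z * (-c * (horiz z * cutoff L z))
        - (-c * (horiz z * cutoff L z)) ^ 2) := by
  have hL0 : 0 < L := by linarith
  have hcv := continuous_vert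
  have hch := continuous_horiz
  have hcc := (contDiff_cutoff L).continuous
  have hs := hasCompactSupport_cutoff hL0
  have hi1 : Integrable fun z => horiz z ^ 2 * (2 - cutoff L z) * cutoff L z :=
    Continuous.integrable_of_hasCompactSupport (by fun_prop) hs.mul_left
  have hi2 : Integrable fun z => vert z * horiz z * cutoff L z :=
    Continuous.integrable_of_hasCompactSupport (by fun_prop) hs.mul_left
  -- The `vert * horiz` term is odd and integrates to zero. The weight `(2 - cutoff) * cutoff` is
  -- nonnegative, and equals 1 on the disc of radius `L`.
  have h : ∀ z, 2 * profile s c z * (-c * (horiz z * cutoff L z))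
        - (-c * (horiz z * cutoff L z)) ^ 2
      = c ^ 2 * (horiz z ^ 2 * (2 - cutoff L z) * cutoff L z)
        - (2 * s * c) * (vert z * horiz z * cutoff L z) := fun z => by
    rw [profile]; ring
  simp_rw [h]
  rw [integral_sub (hi1.const_mul _) (hi2.const_mul _), integral_const_mul, integral_const_mul,
    integral_eq_zero_of_odd (f := fun z => vert z * horiz z * cutoff L z)
      (fun z => by rw [vert_neg, horiz_neg, cutoff_neg]; ring), mul_zero, sub_zero]
  refine mul_le_mul_of_nonneg_left ?_ (sq_nonneg c)
  have h1 : ∫ z in ball (0 : ℂ) L, horiz z ^ 2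
      ≤ ∫ z, horiz z ^ 2 * (2 - cutoff L z) * cutoff L z := by
    calc ∫ z in ball (0 : ℂ) L, horiz z ^ 2
        = ∫ z in ball (0 : ℂ) L, horiz z ^ 2 * (2 - cutoff L z) * cutoff L z := by
          refine setIntegral_congr_fun measurableSet_ball fun z hz => ?_
          have := cutoff_eq_one hL0 (z := z) (by simpa using (mem_ball_zero_iff.1 hz).le)
          simp only [this]
          ring
      _ ≤ _ := setIntegral_le_integral hi1 (Filter.Eventually.of_forall fun z =>
          mul_nonneg (mul_nonneg (sq_nonneg _) (by linarith [cutoff_le_one L z]))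
            (cutoff_nonneg L z))
  rw [integral_ball_horiz_sq hL0.le] at h1
  have h2 : 2 * Real.log L ≤ Real.log (1 + L ^ 2) := by
    have : 2 * Real.log L = Real.log (L ^ 2) := by rw [Real.log_pow]; norm_num
    rw [this]
    exact Real.log_le_log (by positivity) (by linarith)
  have h3 : 0 ≤ 1 / (1 + L ^ 2) := by positivity
  have hpi := Real.pi_pos
  nlinarith

end Integrals

/-! ### Control of the perturbation -/

section Estimates

open Metric

/-- The harmonic conjugate `2 y / (1 + |z|²)` of `horiz`, cut off at scale `L`. -/
def swirl (L : ℝ) (z : ℂ) : ℝ := 2 * z.im / (1 + Complex.normSq z) * cutoff L z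

lemma contDiff_swirl (L : ℝ) : ContDiff ℝ ((⊤ : ℕ∞) : WithTop ℕ∞) (swirl L) :=
  ((contDiff_const.mul Complex.imCLM.contDiff).div (contDiff_const.add contDiff_normSq)
    fun z => (one_add_normSq_pos z).ne').mul (contDiff_cutoff L)

/-- The decay `1/|z|` of `swirl` compensates the growth of the rotation field, giving a bound
independent of `L`. -/
lemma norm_mul_abs_swirl_le {L : ℝ} (z : ℂ) : ‖z‖ * |swirl L z| ≤ 2 := by
  have hp := one_add_normSq_pos z
  have h1 : |swirl L z| ≤ 2 * ‖z‖ / (1 + Complex.normSq z) := by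
    rw [swirl, abs_mul, abs_div, abs_of_pos hp, abs_mul, abs_of_nonneg (cutoff_nonneg L z),
      abs_two]
    calc _ ≤ 2 * |z.im| / (1 + Complex.normSq z) * 1 := by
          gcongr
          exact cutoff_le_one L z
      _ ≤ _ := by
          rw [mul_one]
          gcongr
          exact Complex.abs_im_le_norm z
  calc ‖z‖ * |swirl L z| ≤ ‖z‖ * (2 * ‖z‖ / (1 + Complex.normSq z)) := by gcongr
    _ ≤ 2 := by
        rw [mul_div_assoc', div_le_iff₀ hp, Complex.normSq_eq_norm_sq]
        nlinarith

lemma swirl_eq_zero {L : ℝ} (hL : 0 < L) {z : ℂ} (hz : 2 * L ≤ ‖z‖) : swirl L z = 0 := by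
  rw [swirl, cutoff_eq_zero hL hz, mul_zero]

/-- The angular derivative of `swirl` is the truncated horizontal profile. -/
lemma fderiv_swirl_comp {ρ : ℝ} (z₀ : ℂ) (φ α L : ℝ) (x : ℂ) :
    fderiv ℝ (fun x => swirl L (dilRot ρ φ α * (x - z₀))) x (Complex.I * (x - z₀))
      = horiz (dilRot ρ φ α * (x - z₀)) * cutoff L (dilRot ρ φ α * (x - z₀)) := by
  set w := dilRot ρ φ α * (x - z₀) with hw
  have hdiff : Differentiable ℝ fun x => swirl L (dilRot ρ φ α * (x - z₀)) :=
    ((contDiff_swirl L).comp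
      (contDiff_const.mul (contDiff_id.sub contDiff_const))).differentiable (by simp)
  have hexp : HasDerivAt (fun t : ℝ => Complex.exp (t * Complex.I)) Complex.I 0 := by
    have h := ((Complex.ofRealCLM.hasDerivAt (x := (0 : ℝ))).mul_const Complex.I).cexp
    simpa using h
  have hcurve : HasDerivAt (fun t : ℝ => z₀ + Complex.exp (t * Complex.I) * (x - z₀))
      (Complex.I * (x - z₀)) 0 := (hexp.mul_const _).const_add _
  have h0 : z₀ + Complex.exp ((0 : ℝ) * Complex.I) * (x - z₀) = x := by simp
  have h1 : HasDerivAt (fun t : ℝ => swirl L (dilRot ρ φ α *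
      (z₀ + Complex.exp (t * Complex.I) * (x - z₀) - z₀)))
      (fderiv ℝ (fun x => swirl L (dilRot ρ φ α * (x - z₀))) x (Complex.I * (x - z₀))) 0 := by
    have hd := (hdiff x).hasFDerivAt
    rw [← h0] at hd
    have := hd.comp_hasDerivAt (0 : ℝ) hcurve
    rwa [h0] at this
  -- Along circles about `z₀` the modulus, hence the denominator and the cutoff, is constant; only
  -- the imaginary part varies.
  have h2 : ∀ t : ℝ, swirl L (dilRot ρ φ α *
      (z₀ + Complex.exp (t * Complex.I) * (x - z₀) - z₀))
      = 2 * (Complex.exp (t * Complex.I) * w).im / (1 + Complex.normSq w) * cutoff L w := by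
    intro t
    have e1 : dilRot ρ φ α * (z₀ + Complex.exp (t * Complex.I) * (x - z₀) - z₀)
        = Complex.exp (t * Complex.I) * w := by rw [hw]; ring
    have e2 : Complex.normSq (Complex.exp (t * Complex.I) * w) = Complex.normSq w := by
      rw [Complex.normSq_eq_norm_sq, norm_mul, Complex.norm_exp_ofReal_mul_I, one_mul,
        Complex.normSq_eq_norm_sq]
    rw [e1, swirl, cutoff, e2, cutoff]
  simp_rw [h2] at h1
  have h3 : HasDerivAt (fun t : ℝ => (Complex.exp (t * Complex.I) * w).im)
      (Complex.I * w).im 0 := Complex.imCLM.hasFDerivAt.comp_hasDerivAt 0 (hexp.mul_const w)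
  have h4 := (((h3.const_mul 2).div_const (1 + Complex.normSq w)).mul_const (cutoff L w))
  rw [h1.unique h4, horiz, Complex.I_mul_im]

/-- The square integral of the weak gradient. -/
lemma integral_weakPartial_sq_le {f : ℂ → ℝ} (h1 : ∃ g, HasWeakPartial 1 f g)
    (hI : ∃ g, HasWeakPartial Complex.I f g) {D : ℝ} (hD : 0 ≤ D)
    (hf : gradEnergy f ≤ ENNReal.ofReal D) :
    Integrable (fun x => weakPartial 1 f x ^ 2 + weakPartial Complex.I f x ^ 2) ∧
    ∫ x, (weakPartial 1 f x ^ 2 + weakPartial Complex.I f x ^ 2) ≤ D := by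
  have hm1 := (hasWeakPartial_weakPartial h1).locInt_deriv.aestronglyMeasurable
  have hmI := (hasWeakPartial_weakPartial hI).locInt_deriv.aestronglyMeasurable
  have hm : AEStronglyMeasurable
      (fun x => weakPartial 1 f x ^ 2 + weakPartial Complex.I f x ^ 2) volume :=
    (hm1.pow 2).add (hmI.pow 2)
  have hnn : ∀ x, 0 ≤ weakPartial 1 f x ^ 2 + weakPartial Complex.I f x ^ 2 :=
    fun x => by positivity
  have hE : ∫⁻ x, ENNReal.ofReal (weakPartial 1 f x ^ 2 + weakPartial Complex.I f x ^ 2)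
      = gradEnergy f := by
    refine lintegral_congr fun x => ?_
    rw [gradSq, ENNReal.ofReal_add (sq_nonneg _) (sq_nonneg _), ← sq_abs,
      ← sq_abs (weakPartial Complex.I f x), ENNReal.ofReal_pow (abs_nonneg _),
      ENNReal.ofReal_pow (abs_nonneg _), ← Real.norm_eq_abs, ← Real.norm_eq_abs,
      ofReal_norm, ofReal_norm]
  refine ⟨⟨hm, ?_⟩, ?_⟩
  · rw [hasFiniteIntegral_iff_ofReal (Filter.Eventually.of_forall hnn), hE]
    exact hf.trans_lt ENNReal.ofReal_lt_top
  · rw [integral_eq_lintegral_of_nonneg_ae (Filter.Eventually.of_forall hnn) hm, hE]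
    exact ENNReal.toReal_le_of_le_ofReal hD hf

/-- A function with small gradient is almost orthogonal to the truncated horizontal profile. -/
lemma abs_integral_mul_horiz_le {f : ℂ → ℝ} (h1 : ∃ g, HasWeakPartial 1 f g)
    (hI : ∃ g, HasWeakPartial Complex.I f g) {D : ℝ} (hD : 0 ≤ D)
    (hf : gradEnergy f ≤ ENNReal.ofReal D) {ρ : ℝ} (hρ : 0 < ρ) {L : ℝ} (hL : 0 < L)
    (z₀ : ℂ) (φ α : ℝ) :
    |∫ x, horiz (dilRot ρ φ α * (x - z₀)) * cutoff L (dilRot ρ φ α * (x - z₀)) * f x|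
      ≤ ρ ^ 2 * (8 * Real.pi + L ^ 2 * D) := by
  set η : ℂ → ℝ := fun x => swirl L (dilRot ρ φ α * (x - z₀)) with hη
  have hηd : ContDiff ℝ ((⊤ : ℕ∞) : WithTop ℕ∞) η :=
    (contDiff_swirl L).comp (contDiff_const.mul (contDiff_id.sub contDiff_const))
  have hnorm : ∀ x, ‖dilRot ρ φ α * (x - z₀)‖ = ρ⁻¹ * ‖x - z₀‖ := fun x => by
    rw [norm_mul, norm_dilRot hρ]
  have hη0 : ∀ x, x ∉ ball z₀ (2 * ρ * L) → η x = 0 := fun x hx => by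
    refine swirl_eq_zero hL ?_
    rw [hnorm, le_inv_mul_iff₀ hρ]
    rw [mem_ball, not_lt, dist_eq_norm] at hx
    linarith
  have hηb : ∀ x, ‖x - z₀‖ * |η x| ≤ 2 * ρ := fun x => by
    have := norm_mul_abs_swirl_le (L := L) (dilRot ρ φ α * (x - z₀))
    rw [hnorm, mul_assoc, inv_mul_le_iff₀ hρ] at this
    linarith
  have hηc : HasCompactSupport η := HasCompactSupport.intro (isCompact_closedBall z₀ (2 * ρ * L))
    fun x hx => hη0 x fun h => hx (ball_subset_closedBall h)
  set Y : ℂ → ℝ := fun x => (x - z₀).im * η x with hY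
  set X : ℂ → ℝ := fun x => (x - z₀).re * η x with hX
  have hre : ContDiff ℝ ((⊤ : ℕ∞) : WithTop ℕ∞) fun x : ℂ => (x - z₀).re :=
    Complex.reCLM.contDiff.comp (contDiff_id.sub contDiff_const)
  have him : ContDiff ℝ ((⊤ : ℕ∞) : WithTop ℕ∞) fun x : ℂ => (x - z₀).im :=
    Complex.imCLM.contDiff.comp (contDiff_id.sub contDiff_const)
  have hYd : ContDiff ℝ ((⊤ : ℕ∞) : WithTop ℕ∞) Y := him.mul hηd
  have hXd : ContDiff ℝ ((⊤ : ℕ∞) : WithTop ℕ∞) X := hre.mul hηd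
  have hYc : HasCompactSupport Y := hηc.mul_left
  have hXc : HasCompactSupport X := hηc.mul_left
  have hYf : ∀ x, fderiv ℝ Y x 1 = (x - z₀).im * fderiv ℝ η x 1 := fun x => by
    have h := ((Complex.imCLM.hasFDerivAt.comp x ((hasFDerivAt_id x).sub_const z₀)).mul
      (hηd.differentiable (by simp) x).hasFDerivAt)
    have h' : HasFDerivAt Y _ x := h
    rw [h'.fderiv]
    simp
  have hXf : ∀ x, fderiv ℝ X x Complex.I = (x - z₀).re * fderiv ℝ η x Complex.I := fun x => by
    have h := ((Complex.reCLM.hasFDerivAt.comp x ((hasFDerivAt_id x).sub_const z₀)).mul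
      (hηd.differentiable (by simp) x).hasFDerivAt)
    have h' : HasFDerivAt X _ x := h
    rw [h'.fderiv]
    simp
  -- The rotation field `i (x - z₀)` is divergence free, so the angular derivative of `η` is itself
  -- a divergence, ready for integration by parts.
  have hkey : ∀ x, horiz (dilRot ρ φ α * (x - z₀)) * cutoff L (dilRot ρ φ α * (x - z₀))
      = fderiv ℝ X x Complex.I - fderiv ℝ Y x 1 := fun x => by
    rw [← fderiv_swirl_comp, hYf, hXf]
    have : Complex.I * (x - z₀) = (x - z₀).re • Complex.I - (x - z₀).im • (1 : ℂ) := by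
      apply Complex.ext <;> simp
    rw [this, map_sub, map_smul, map_smul]
    rfl
  have hw1 := hasWeakPartial_weakPartial h1
  have hwI := hasWeakPartial_weakPartial hI
  set g := weakPartial 1 f
  set k := weakPartial Complex.I f
  have hiY : Integrable fun x => Y x • g x :=
    hw1.locInt_deriv.integrable_smul_left_of_hasCompactSupport hYd.continuous hYc
  have hiX : Integrable fun x => X x • k x :=
    hwI.locInt_deriv.integrable_smul_left_of_hasCompactSupport hXd.continuous hXc
  have hint : ∫ x, horiz (dilRot ρ φ α * (x - z₀)) * cutoff L (dilRot ρ φ α * (x - z₀)) * f x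
      = ∫ x, (Y x • g x - X x • k x) := by
    simp_rw [hkey, sub_mul, ← smul_eq_mul]
    rw [integral_sub, hw1.integral_eq Y hYd hYc, hwI.integral_eq X hXd hXc,
      integral_sub hiY hiX]
    · ring
    · exact hw1.locInt.integrable_smul_left_of_hasCompactSupport
        (continuous_fderiv_apply_of_contDiff hXd _) (hasCompactSupport_fderiv_apply hXc _)
    · exact hw1.locInt.integrable_smul_left_of_hasCompactSupport
        (continuous_fderiv_apply_of_contDiff hYd _) (hasCompactSupport_fderiv_apply hYc _)
  obtain ⟨hGi, hG⟩ := integral_weakPartial_sq_le h1 hI hD hf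
  have hind : Integrable ((ball z₀ (2 * ρ * L)).indicator fun _ => 2 / L ^ 2) :=
    (integrable_indicator_iff measurableSet_ball).2
      (integrableOn_ball_of_continuous continuous_const _ _)
  have hbound : ∀ x, ‖Y x • g x - X x • k x‖ ≤
      (ball z₀ (2 * ρ * L)).indicator (fun _ => 2 / L ^ 2) x
        + ρ ^ 2 * L ^ 2 * (g x ^ 2 + k x ^ 2) := fun x => by
    by_cases hx : x ∈ ball z₀ (2 * ρ * L)
    · rw [Set.indicator_of_mem hx]
      have hYb : |Y x| ≤ 2 * ρ := by
        rw [hY, abs_mul]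
        exact (mul_le_mul_of_nonneg_right (Complex.abs_im_le_norm _) (abs_nonneg _)).trans (hηb x)
      have hXb : |X x| ≤ 2 * ρ := by
        rw [hX, abs_mul]
        exact (mul_le_mul_of_nonneg_right (Complex.abs_re_le_norm _) (abs_nonneg _)).trans (hηb x)
      -- The weight is chosen so that the constant part, integrated over a disc of area `4π ρ² L²`,
      -- is free of `L`.
      have hyoung : ∀ a : ℝ, 2 * ρ * |a| ≤ 1 / L ^ 2 + ρ ^ 2 * L ^ 2 * a ^ 2 := fun a => by
        have h := two_mul_le_add_sq (1 / L) (ρ * L * |a|)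
        rw [mul_pow, sq_abs, mul_pow, div_pow, one_pow] at h
        have e : 2 * (1 / L) * (ρ * L * |a|) = 2 * ρ * |a| := by field_simp
        linarith
      calc ‖Y x • g x - X x • k x‖ ≤ |Y x| * |g x| + |X x| * |k x| := by
            refine (norm_sub_le _ _).trans ?_
            rw [norm_smul, norm_smul]
            rfl
        _ ≤ 2 * ρ * |g x| + 2 * ρ * |k x| := by gcongr
        _ ≤ (1 / L ^ 2 + ρ ^ 2 * L ^ 2 * g x ^ 2) + (1 / L ^ 2 + ρ ^ 2 * L ^ 2 * k x ^ 2) :=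
            add_le_add (hyoung _) (hyoung _)
        _ = _ := by ring
    · have : η x = 0 := hη0 x hx
      simp only [hY, hX, this, mul_zero, zero_smul, sub_zero, norm_zero,
        Set.indicator_of_notMem hx, zero_add]
      positivity
  have hvol : ∫ x, (ball z₀ (2 * ρ * L)).indicator (fun _ => 2 / L ^ 2) x
      = ρ ^ 2 * (8 * Real.pi) := by
    rw [integral_indicator measurableSet_ball, setIntegral_const, Measure.real,
      Complex.volume_ball, ENNReal.toReal_mul, ENNReal.toReal_pow,
      ENNReal.toReal_ofReal (by positivity)]
    simp
    field_simp
    ring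
  rw [hint, ← Real.norm_eq_abs]
  refine (norm_integral_le_of_norm_le (hind.add (hGi.const_mul (ρ ^ 2 * L ^ 2)))
    (Filter.Eventually.of_forall hbound)).trans ?_
  rw [integral_add' hind (hGi.const_mul _), hvol, integral_const_mul]
  have := mul_le_mul_of_nonneg_left hG (by positivity : 0 ≤ ρ ^ 2 * L ^ 2)
  linarith

/-- The Moser–Trudinger bound controls the square integral on large discs. -/
lemma lintegral_ball_sq_le {f : ℂ → ℝ} {D : ℝ} (hD : 0 < D)
    (hf : gradEnergy f ≤ ENNReal.ofReal D) {ρ : ℝ} (hρ : 0 < ρ) {L : ℝ} (hL : 1 ≤ L)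
    {z₀ : ℂ} {φ α β c : ℝ} (hc : 0 < c)
    (hMT : moserTrudingerIntegral f (mobiusMap z₀ ρ φ α β) ≤ ENNReal.ofReal c) :
    ∫⁻ x in ball z₀ (ρ * L), ENNReal.ofReal (f x ^ 2)
      ≤ ENNReal.ofReal (D * ρ ^ 2 * L ^ 2 * (2 * Real.pi * Real.log L + c / 2)) := by
  have hL0 : 0 < L := by linarith
  have hlog : 0 ≤ Real.log L := Real.log_nonneg hL
  have hL2 : 1 ≤ L ^ 2 := by nlinarith
  set κ : ℂ → ℝ≥0∞ := fun x =>
    EReal.exp ((ENNReal.ofReal (f x ^ 2) / gradEnergy f : ℝ≥0∞) : EReal) with hκ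
  -- Replacing the energy by the larger `D > 0` only lowers the exponent; this covers zero energy
  -- too.
  have hexp : ∀ x, ENNReal.ofReal (Real.exp (f x ^ 2 / D)) ≤ κ x := fun x => by
    have h0 : 0 ≤ f x ^ 2 / D := by positivity
    have : ENNReal.ofReal (Real.exp (f x ^ 2 / D))
        = EReal.exp ((ENNReal.ofReal (f x ^ 2 / D) : ℝ≥0∞) : EReal) := by
      rw [EReal.coe_ennreal_ofReal, max_eq_left h0, EReal.exp_coe]
    rw [this, ENNReal.ofReal_div_of_pos hD]
    exact EReal.exp_monotone (EReal.coe_ennreal_le_coe_ennreal_iff.2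
      (ENNReal.div_le_div_left hf _))
  -- This is `t + 1 ≤ exp t` at `t = f²/D - log L²`. The factor `1/L²` offsets half of the `L⁴` lost
  -- below, where `|∇Ψ|²` may be as small as `2/(ρ² L⁴)`.
  have hpt : ∀ x, f x ^ 2 ≤ D * (2 * Real.log L) + D / L ^ 2 * Real.exp (f x ^ 2 / D) :=
    fun x => by
    have h := Real.add_one_le_exp (f x ^ 2 / D - Real.log (L ^ 2))
    rw [Real.exp_sub, Real.exp_log (by positivity), Real.log_pow] at h
    push_cast at h
    have h' := mul_le_mul_of_nonneg_left h hD.le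
    have e1 : D * (f x ^ 2 / D - 2 * Real.log L + 1)
        = f x ^ 2 - D * (2 * Real.log L) + D := by field_simp
    have e2 : D * (Real.exp (f x ^ 2 / D) / L ^ 2) = D / L ^ 2 * Real.exp (f x ^ 2 / D) := by
      ring
    linarith
  have hae : ∀ᵐ x, x ∈ ball z₀ (ρ * L) → ENNReal.ofReal (f x ^ 2) ≤
      ENNReal.ofReal (D * (2 * Real.log L))
        + ENNReal.ofReal (D / L ^ 2 * (ρ ^ 2 * L ^ 4 / 2))
          * (κ x * gradSq (mobiusMap z₀ ρ φ α β) x) := by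
    filter_upwards [gradSq_mobiusMap hρ z₀ φ α β] with x hx hmem
    have hone : 1 ≤ ENNReal.ofReal (ρ ^ 2 * L ^ 4 / 2) * gradSq (mobiusMap z₀ ρ φ α β) x := by
      rw [hx, ← ENNReal.ofReal_mul (by positivity), ← ENNReal.ofReal_one]
      apply ENNReal.ofReal_le_ofReal
      have hn : Complex.normSq (x - z₀) / ρ ^ 2 ≤ L ^ 2 := by
        rw [mem_ball, dist_eq_norm] at hmem
        rw [Complex.normSq_eq_norm_sq, div_le_iff₀ (by positivity), ← mul_pow]
        refine pow_le_pow_left₀ (norm_nonneg _) ?_ 2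
        linarith
      have hn0 : 0 ≤ Complex.normSq (x - z₀) / ρ ^ 2 :=
        div_nonneg (Complex.normSq_nonneg _) (by positivity)
      have hb : (1 + Complex.normSq (x - z₀) / ρ ^ 2) ^ 2 ≤ 4 * L ^ 4 := by
        have : (1 + Complex.normSq (x - z₀) / ρ ^ 2) ^ 2 ≤ (2 * L ^ 2) ^ 2 :=
          pow_le_pow_left₀ (by linarith) (by linarith) 2
        linarith [this, (by ring : (2 * L ^ 2) ^ 2 = 4 * L ^ 4)]
      have e : ρ ^ 2 * L ^ 4 / 2 * (8 / ρ ^ 2 / (1 + Complex.normSq (x - z₀) / ρ ^ 2) ^ 2)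
          = 4 * L ^ 4 / (1 + Complex.normSq (x - z₀) / ρ ^ 2) ^ 2 := by
        field_simp
        ring
      rw [e, one_le_div (by positivity)]
      exact hb
    calc ENNReal.ofReal (f x ^ 2)
        ≤ ENNReal.ofReal (D * (2 * Real.log L) + D / L ^ 2 * Real.exp (f x ^ 2 / D)) :=
          ENNReal.ofReal_le_ofReal (hpt x)
      _ = ENNReal.ofReal (D * (2 * Real.log L))
          + ENNReal.ofReal (D / L ^ 2) * ENNReal.ofReal (Real.exp (f x ^ 2 / D)) := by
          rw [ENNReal.ofReal_add (by positivity) (by positivity),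
            ENNReal.ofReal_mul (p := D / L ^ 2) (by positivity)]
      _ ≤ ENNReal.ofReal (D * (2 * Real.log L)) + ENNReal.ofReal (D / L ^ 2)
          * (κ x * (ENNReal.ofReal (ρ ^ 2 * L ^ 4 / 2)
            * gradSq (mobiusMap z₀ ρ φ α β) x)) := by
          gcongr
          exact (hexp x).trans (le_mul_of_one_le_right' hone)
      _ = _ := by
          rw [ENNReal.ofReal_mul (p := D / L ^ 2) (by positivity)]
          ring
  calc ∫⁻ x in ball z₀ (ρ * L), ENNReal.ofReal (f x ^ 2)
      ≤ ∫⁻ x in ball z₀ (ρ * L), (ENNReal.ofReal (D * (2 * Real.log L))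
        + ENNReal.ofReal (D / L ^ 2 * (ρ ^ 2 * L ^ 4 / 2))
          * (κ x * gradSq (mobiusMap z₀ ρ φ α β) x)) :=
        lintegral_mono_ae ((ae_restrict_iff' measurableSet_ball).2 hae)
    _ = ENNReal.ofReal (D * (2 * Real.log L)) * volume (ball z₀ (ρ * L))
        + ENNReal.ofReal (D / L ^ 2 * (ρ ^ 2 * L ^ 4 / 2))
          * ∫⁻ x in ball z₀ (ρ * L), κ x * gradSq (mobiusMap z₀ ρ φ α β) x := by
        rw [lintegral_add_left measurable_const, setLIntegral_const,
          lintegral_const_mul' _ _ ENNReal.ofReal_ne_top]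
    _ ≤ ENNReal.ofReal (D * (2 * Real.log L)) * volume (ball z₀ (ρ * L))
        + ENNReal.ofReal (D / L ^ 2 * (ρ ^ 2 * L ^ 4 / 2)) * ENNReal.ofReal c := by
        gcongr
        exact (setLIntegral_le_lintegral _ _).trans hMT
    _ = _ := by
        have hv : volume (ball z₀ (ρ * L)) = ENNReal.ofReal ((ρ * L) ^ 2 * Real.pi) := by
          rw [Complex.volume_ball, ENNReal.ofReal_mul (p := (ρ * L) ^ 2) (by positivity),
            ENNReal.ofReal_pow (by positivity), ← NNReal.coe_real_pi, ENNReal.ofReal_coe_nnreal]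
        rw [hv, ← ENNReal.ofReal_mul (by positivity), ← ENNReal.ofReal_mul (by positivity),
          ← ENNReal.ofReal_add (by positivity) (by positivity)]
        congr 1
        field_simp

end Estimates

/-! ### The two lower bounds and their combination -/

section Main

open Metric

lemma mobiusMap_two_eq_profile (z₀ : ℂ) (ρ φ α β : ℝ) (x : ℂ) :
    mobiusMap z₀ ρ φ α β x 2 = profile (Real.sin (2 * β)) (Real.cos (2 * β))
      (dilRot ρ φ α * (x - z₀)) := by
  rw [mobiusMap_two]; rfl

lemma hasWeakPartial_sub_mobiusMap {m : ℂ → R3} {e : ℂ} (h : ∃ g, HasWeakPartial e m g)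
    (z₀ : ℂ) (ρ φ α β : ℝ) :
    ∃ g, HasWeakPartial e (fun x => m x - mobiusMap z₀ ρ φ α β x) g :=
  let ⟨_, hg⟩ := h
  ⟨_, hg.sub (hasWeakPartial_of_contDiff (contDiff_mobiusMap z₀ ρ φ α β) e)⟩

lemma HasWeakPartial.exists_coord {v : ℂ → R3} {e : ℂ} (h : ∃ g, HasWeakPartial e v g)
    (i : Fin 3) : ∃ g, HasWeakPartial e (fun x => v x i) g :=
  let ⟨_, hg⟩ := h
  ⟨_, hg.clm_comp (EuclideanSpace.proj (𝕜 := ℝ) i)⟩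

lemma MemW.aestronglyMeasurable_coord {q : ℤ} {m : ℂ → R3} (hm : MemW q m) (i : Fin 3) :
    AEStronglyMeasurable (fun x => m x i) volume :=
  (EuclideanSpace.proj (𝕜 := ℝ) i).continuous.comp_aestronglyMeasurable
    hm.memH.aestronglyMeasurable

lemma MemW.integrable_sq {q : ℤ} {m : ℂ → R3} (hm : MemW q m) :
    Integrable fun x => m x 2 ^ 2 := by
  refine ⟨(hm.aestronglyMeasurable_coord 2).pow 2, ?_⟩
  rw [hasFiniteIntegral_iff_ofReal (Filter.Eventually.of_forall fun x => sq_nonneg _)]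
  exact hm.anisotropy_lt_top

lemma MemW.toReal_anisotropy {q : ℤ} {m : ℂ → R3} (hm : MemW q m) :
    (anisotropy m).toReal = ∫ x, m x 2 ^ 2 :=
  (integral_eq_lintegral_of_nonneg_ae (Filter.Eventually.of_forall fun _ => sq_nonneg _)
    ((hm.aestronglyMeasurable_coord 2).pow 2)).symm

/-- Logarithmic lower bound for the anisotropy. -/
lemma MemW.log_le_anisotropy {q : ℤ} {m : ℂ → R3} (hm : MemW q m) {z₀ : ℂ} {ρ φ α β : ℝ}
    (hρ : 0 < ρ) {D : ℝ} (hD : 0 ≤ D)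
    (hgrad : gradEnergy (fun x => (m x - mobiusMap z₀ ρ φ α β x) 2) ≤ ENNReal.ofReal D)
    {L : ℝ} (hL : 1 ≤ L) :
    Real.cos (2 * β) ^ 2 * (4 * Real.pi * Real.log L - 2 * Real.pi)
      - 2 * (8 * Real.pi + L ^ 2 * D) ≤ (anisotropy m).toReal / ρ ^ 2 := by
  have hL0 : 0 < L := by linarith
  set s := Real.sin (2 * β)
  set c := Real.cos (2 * β)
  set f : ℂ → ℝ := fun x => (m x - mobiusMap z₀ ρ φ α β x) 2 with hf
  have hw1 := HasWeakPartial.exists_coord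
    (hasWeakPartial_sub_mobiusMap hm.memH.hasWeakPartial_one z₀ ρ φ α β) 2
  have hwI := HasWeakPartial.exists_coord
    (hasWeakPartial_sub_mobiusMap hm.memH.hasWeakPartial_I z₀ ρ φ α β) 2
  have hcross := abs_integral_mul_horiz_le hw1 hwI hD hgrad hρ hL0 z₀ φ α
  set w : ℂ → ℂ := fun x => dilRot ρ φ α * (x - z₀) with hw
  have hwc : Continuous w := continuous_const.mul (continuous_id.sub continuous_const)
  set G : ℂ → ℝ := fun x => horiz (w x) * cutoff L (w x) with hG
  have hGcont : Continuous G :=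
    (continuous_horiz.comp hwc).mul ((contDiff_cutoff L).continuous.comp hwc)
  have hGsupp : HasCompactSupport G :=
    HasCompactSupport.intro (isCompact_closedBall z₀ (2 * ρ * L)) fun x hx => by
      have hx' : 2 * L ≤ ‖w x‖ := by
        rw [mem_closedBall, not_le, dist_eq_norm] at hx
        rw [hw, norm_mul, norm_dilRot hρ, le_inv_mul_iff₀ hρ]
        linarith
      rw [hG]
      simp only [cutoff_eq_zero hL0 hx', mul_zero]
  have hmf : ∀ x, m x 2 = profile s c (w x) + f x := fun x => by
    rw [← mobiusMap_two_eq_profile]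
    simp [hf]
  have hfloc : LocallyIntegrable f volume := by
    obtain ⟨g, hg⟩ := hw1
    exact hg.locInt
  have hGf : Integrable fun x => G x * f x :=
    hfloc.integrable_smul_left_of_hasCompactSupport hGcont hGsupp
  have hPcont : Continuous fun x => profile s c (w x) := (continuous_profile s c).comp hwc
  have hmain : Integrable fun x => 2 * profile s c (w x) * (-c * G x) - (-c * G x) ^ 2 := by
    have : (fun x => 2 * profile s c (w x) * (-c * G x) - (-c * G x) ^ 2)
        = fun x => (2 * profile s c (w x) * (-c) - c ^ 2 * G x) * G x := by
      ext x; ring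
    rw [this]
    exact Continuous.integrable_of_hasCompactSupport (by fun_prop) hGsupp.mul_left
  have hchange : ∫ x, (2 * profile s c (w x) * (-c * G x) - (-c * G x) ^ 2)
      = ρ ^ 2 * ∫ z, (2 * profile s c z * (-c * (horiz z * cutoff L z))
        - (-c * (horiz z * cutoff L z)) ^ 2) :=
    integral_comp_dilRot hρ z₀ φ α fun z => 2 * profile s c z * (-c * (horiz z * cutoff L z))
      - (-c * (horiz z * cutoff L z)) ^ 2
  have hle : ∫ x, ((2 * profile s c (w x) * (-c * G x) - (-c * G x) ^ 2)
      + (-2 * c) * (G x * f x)) ≤ ∫ x, m x 2 ^ 2 := by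
    refine integral_mono (hmain.add (hGf.const_mul _)) hm.integrable_sq fun x => ?_
    simp only [hmf]
    -- This is `m₃² ≥ 2 m₃ g - g²` with `g = -c * G`.
    linarith [sq_nonneg (profile s c (w x) + f x + c * G x)]
  rw [integral_add hmain (hGf.const_mul _), hchange, integral_const_mul] at hle
  have htest := le_integral_profile_test s c hL
  have hcabs : |c| ≤ 1 := Real.abs_cos_le_one _
  have hc2 : -(2 * (ρ ^ 2 * (8 * Real.pi + L ^ 2 * D))) ≤ (-2 * c) * ∫ x, G x * f x := by
    have h : |(-2 * c) * ∫ x, G x * f x| ≤ 2 * (ρ ^ 2 * (8 * Real.pi + L ^ 2 * D)) := by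
      rw [abs_mul, abs_mul, abs_neg, abs_two]
      calc 2 * |c| * |∫ x, G x * f x| ≤ 2 * 1 * (ρ ^ 2 * (8 * Real.pi + L ^ 2 * D)) := by
            gcongr
        _ = _ := by ring
    exact (abs_le.1 h).1
  rw [hm.toReal_anisotropy, le_div_iff₀ (by positivity)]
  have := mul_le_mul_of_nonneg_left htest (sq_nonneg ρ)
  linarith

/-- Quadratic lower bound for the anisotropy, up to a logarithmic error. -/
lemma MemW.sq_le_anisotropy_add_log {q : ℤ} {m : ℂ → R3} (hm : MemW q m) {z₀ : ℂ}
    {ρ φ α β : ℝ} (hρ : 0 < ρ) {D : ℝ} (hD : 0 < D)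
    (hgrad : gradEnergy (fun x => (m x - mobiusMap z₀ ρ φ α β x) 2) ≤ ENNReal.ofReal D)
    {L : ℝ} (hL : 5 ≤ L) {b : ℝ} (hb : 0 < b)
    (hMT : moserTrudingerIntegral (fun x => (m x - mobiusMap z₀ ρ φ α β x) 2)
      (mobiusMap z₀ ρ φ α β) ≤ ENNReal.ofReal b) :
    Real.sin (2 * β) ^ 2 * L ^ 2 / 2 - D * L ^ 2 * (2 * Real.pi * Real.log L + b / 2)
      ≤ (anisotropy m).toReal / ρ ^ 2 := by
  set s := Real.sin (2 * β)
  set c := Real.cos (2 * β)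
  set f : ℂ → ℝ := fun x => (m x - mobiusMap z₀ ρ φ α β x) 2 with hf
  have hsq := lintegral_ball_sq_le hD hgrad hρ (by linarith : 1 ≤ L) hb hMT
  have hlog : 0 ≤ Real.log L := Real.log_nonneg (by linarith)
  have hfm : AEStronglyMeasurable f volume :=
    (hm.aestronglyMeasurable_coord 2).sub ((EuclideanSpace.proj (𝕜 := ℝ) 2).continuous.comp
      (contDiff_mobiusMap (n := 1) z₀ ρ φ α β).continuous).aestronglyMeasurable
  have hfi : IntegrableOn (fun x => f x ^ 2) (ball z₀ (ρ * L)) := by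
    refine ⟨(hfm.pow 2).restrict, ?_⟩
    rw [hasFiniteIntegral_iff_ofReal (Filter.Eventually.of_forall fun x => sq_nonneg _)]
    exact hsq.trans_lt ENNReal.ofReal_lt_top
  have hfle : ∫ x in ball z₀ (ρ * L), f x ^ 2
      ≤ D * ρ ^ 2 * L ^ 2 * (2 * Real.pi * Real.log L + b / 2) := by
    rw [integral_eq_lintegral_of_nonneg_ae (Filter.Eventually.of_forall fun x => sq_nonneg _)
      (hfm.pow 2).restrict]
    exact ENNReal.toReal_le_of_le_ofReal (by positivity) hsq
  have hP : IntegrableOn (fun x => profile s c (dilRot ρ φ α * (x - z₀)) ^ 2)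
      (ball z₀ (ρ * L)) :=
    integrableOn_ball_of_continuous (((continuous_profile s c).comp
      (continuous_const.mul (continuous_id.sub continuous_const))).pow 2) _ _
  have hle : ∫ x in ball z₀ (ρ * L),
      (1 / 2 * profile s c (dilRot ρ φ α * (x - z₀)) ^ 2 - f x ^ 2) ≤ ∫ x, m x 2 ^ 2 := by
    refine le_trans (integral_mono ((hP.const_mul _).sub hfi) hm.integrable_sq.integrableOn
      fun x => ?_) (setIntegral_le_integral hm.integrable_sq
        (Filter.Eventually.of_forall fun x => sq_nonneg _))
    have hmf : m x 2 = profile s c (dilRot ρ φ α * (x - z₀)) + f x := by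
      rw [← mobiusMap_two_eq_profile]
      simp [hf]
    simp only [hmf]
    -- This is `(P + f)² ≥ P²/2 - f²`.
    linarith [sq_nonneg (profile s c (dilRot ρ φ α * (x - z₀)) + 2 * f x)]
  rw [integral_sub (hP.const_mul _) hfi, integral_const_mul,
    setIntegral_comp_dilRot hρ z₀ φ α L (fun z => profile s c z ^ 2)] at hle
  have hprof := mul_le_mul_of_nonneg_left (le_integral_ball_profile_sq s c hL) (sq_nonneg ρ)
  rw [hm.toReal_anisotropy, le_div_iff₀ (by positivity)]
  linarith

/-- Combination of a quadratic bound with logarithmic error and a logarithmic bound. -/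
lemma bounds_of_quadratic_of_log {a s c L k₁ k₂ k₃ : ℝ} (hsc : s ^ 2 + c ^ 2 = 1)
    (hk₁ : 0 ≤ k₁) (hk₂ : 0 ≤ k₂) (hk₃ : 0 ≤ k₃)
    (hL : Real.exp 1 + Real.exp k₃ + 8 * (k₁ + k₂) ≤ L)
    (hquad : s ^ 2 * L ^ 2 / 2 - (k₁ * Real.log L + k₂) ≤ a)
    (hlog : 4 * Real.pi * c ^ 2 * Real.log L - k₃ ≤ a) :
    s ^ 2 * L ^ 2 ≤ (6 + 2 * (k₁ + k₂)) * a ∧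
      4 * Real.pi * Real.log L - (16 * Real.pi ^ 2 * (6 + 2 * (k₁ + k₂)) + k₃) ≤ a := by
  have he1 := Real.exp_pos 1
  have he3 := Real.exp_pos k₃
  have hL0 : 0 < L := by linarith
  have hl1 : 1 ≤ Real.log L := (Real.le_log_iff_exp_le hL0).2 (by linarith)
  have hl3 : k₃ ≤ Real.log L := (Real.le_log_iff_exp_le hL0).2 (by linarith)
  have hlL : Real.log L ≤ L := (Real.log_le_sub_one_of_pos hL0).trans (by linarith)
  have hpi := Real.pi_gt_three
  set l := Real.log L
  set K := k₁ + k₂ with hK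
  have hK0 : 0 ≤ K := by positivity
  have hquad' : s ^ 2 * L ^ 2 / 2 - K * l ≤ a := by nlinarith
  -- The cases give the constants `2 + 2K` and `4`; their sum serves both.
  have hfirst : s ^ 2 * L ^ 2 ≤ (6 + 2 * K) * a := by
    by_cases hs : s ^ 2 ≤ 1 / 2
    · have hc : 1 / 2 ≤ c ^ 2 := by linarith
      have h1 : 2 * l ≤ 4 * Real.pi * c ^ 2 * l := by
        apply mul_le_mul_of_nonneg_right _ (by linarith)
        nlinarith
      have hla : l ≤ a := by linarith
      nlinarith [mul_le_mul_of_nonneg_left hla hK0]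
    · have hKl : K * l ≤ s ^ 2 * L ^ 2 / 4 := by
        have h1 : K * l ≤ L / 8 * L := by
          apply mul_le_mul _ hlL (by linarith) (by linarith)
          linarith
        have h2 : 1 / 2 * L ^ 2 ≤ s ^ 2 * L ^ 2 :=
          mul_le_mul_of_nonneg_right (by linarith) (sq_nonneg L)
        nlinarith
      have ha : s ^ 2 * L ^ 2 / 4 ≤ a := by linarith
      have ha0 : 0 ≤ a := le_trans (by positivity) ha
      nlinarith [mul_nonneg hK0 ha0]
  refine ⟨hfirst, ?_⟩
  set C := 6 + 2 * K
  have hC : 0 < C := by positivity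
  by_cases h : 4 * Real.pi * l ≤ a
  · have : 0 ≤ 16 * Real.pi ^ 2 * C := by positivity
    linarith
  · have h1 : s ^ 2 * L ^ 2 ≤ C * (4 * Real.pi * l) :=
      hfirst.trans (mul_le_mul_of_nonneg_left (not_le.1 h).le hC.le)
    have h2 : s ^ 2 * l * L ^ 2 ≤ 4 * Real.pi * C * L ^ 2 := by
      calc s ^ 2 * l * L ^ 2 = s ^ 2 * L ^ 2 * l := by ring
        _ ≤ C * (4 * Real.pi * l) * l := mul_le_mul_of_nonneg_right h1 (by linarith)
        _ = 4 * Real.pi * C * l ^ 2 := by ring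
        _ ≤ _ := mul_le_mul_of_nonneg_left (pow_le_pow_left₀ (by linarith) hlL 2)
            (by positivity)
    -- Hence `4π c² l` differs from `4π l` by at most `16π² C`.
    have h3 : s ^ 2 * l ≤ 4 * Real.pi * C := le_of_mul_le_mul_right h2 (by positivity)
    have h4 : c ^ 2 = 1 - s ^ 2 := by linarith
    rw [h4] at hlog
    have h5 := mul_le_mul_of_nonneg_left h3 (by positivity : 0 ≤ 4 * Real.pi)
    nlinarith

end Main

end Bimeron

end

/-! ### Choice of constants and conclusion -/

theorem lemma5p1 (cStar cMT : ℝ) (hcStar : 0 < cStar) (hcMT : 0 < cMT) :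
    ∃ L₀ C : ℝ, 0 < L₀ ∧ 0 < C ∧
      ∀ (m : ℂ → Bimeron.R3) (z₀ : ℂ) (ρ φ α β : ℝ),
        Bimeron.MemW (-1) m →
        0 < ρ →
        L₀ ≤ Bimeron.scaleL m →
        Bimeron.gradEnergy (fun x => m x - Bimeron.mobiusMap z₀ ρ φ α β x) ≤
          ENNReal.ofReal (cStar / Bimeron.scaleL m ^ 2) →
        Bimeron.moserTrudingerIntegral (fun x => (m x - Bimeron.mobiusMap z₀ ρ φ α β x) 2)
          (Bimeron.mobiusMap z₀ ρ φ α β) ≤ ENNReal.ofReal cMT →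
        1 / C * Real.sin (2 * β) ^ 2 * Bimeron.scaleL m ^ 2 ≤
            (Bimeron.anisotropy m).toReal / ρ ^ 2 ∧
          4 * Real.pi * Real.cos (2 * β) ^ 2 * Real.log (Bimeron.scaleL m) - C ≤
            (Bimeron.anisotropy m).toReal / ρ ^ 2 ∧
          4 * Real.pi * Real.log (Bimeron.scaleL m) - C ≤
            (Bimeron.anisotropy m).toReal / ρ ^ 2 := by
  have hpi := Real.pi_gt_three
  -- With `D = cStar / L²`, the quadratic bound loses `k₁ log L + k₂`. In `k₃`, `2π` comes from the
  -- test integral and `16π + 2 cStar` from the linear term.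
  set k₁ := 2 * Real.pi * cStar with hk₁
  set k₂ := cStar * cMT / 2 with hk₂
  set k₃ := 18 * Real.pi + 2 * cStar with hk₃
  have h1 : 0 < k₁ := by positivity
  have h2 : 0 < k₂ := by positivity
  have h3 : 0 < k₃ := by positivity
  set B := 6 + 2 * (k₁ + k₂) with hB
  have hB0 : 0 < B := by positivity
  -- The 5 is for the disc integral of `vert²`. The exponentials give `log L ≥ 1` and `log L ≥ k₃`,
  -- and the last term lets `s² L²` absorb the logarithmic error when `s² > 1/2`.
  refine ⟨5 + (Real.exp 1 + Real.exp k₃ + 8 * (k₁ + k₂)), B + (16 * Real.pi ^ 2 * B + k₃),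
    by positivity, by positivity, ?_⟩
  intro m z₀ ρ φ α β hm hρ hL hgrad hMT
  set L := Bimeron.scaleL m
  have hE : 0 < Real.exp 1 + Real.exp k₃ + 8 * (k₁ + k₂) := by positivity
  have hL5 : 5 ≤ L := by linarith
  have hL0 : 0 < L := by linarith
  have hD : 0 < cStar / L ^ 2 := by positivity
  have hLD : L ^ 2 * (cStar / L ^ 2) = cStar := by field_simp
  have hgrad' : Bimeron.gradEnergy (fun x => (m x - Bimeron.mobiusMap z₀ ρ φ α β x) 2)
      ≤ ENNReal.ofReal (cStar / L ^ 2) :=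
    (Bimeron.gradEnergy_coord_le
      (Bimeron.hasWeakPartial_sub_mobiusMap hm.memH.hasWeakPartial_one z₀ ρ φ α β)
      (Bimeron.hasWeakPartial_sub_mobiusMap hm.memH.hasWeakPartial_I z₀ ρ φ α β) 2).trans hgrad
  have hlog := hm.log_le_anisotropy hρ hD.le hgrad' (by linarith : 1 ≤ L)
  have hquad := hm.sq_le_anisotropy_add_log hρ hD hgrad' hL5 hcMT hMT
  set a := (Bimeron.anisotropy m).toReal / ρ ^ 2
  have ha : 0 ≤ a := by positivity
  have hlog' : 4 * Real.pi * Real.cos (2 * β) ^ 2 * Real.log L - k₃ ≤ a := by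
    rw [hLD] at hlog
    have := Real.cos_sq_le_one (2 * β)
    nlinarith
  have hquad' : Real.sin (2 * β) ^ 2 * L ^ 2 / 2 - (k₁ * Real.log L + k₂) ≤ a := by
    rw [mul_comm (cStar / L ^ 2), hLD] at hquad
    linarith
  obtain ⟨hA, hA'⟩ := Bimeron.bounds_of_quadratic_of_log (Real.sin_sq_add_cos_sq (2 * β)) h1.le
    h2.le h3.le (by linarith) hquad' hlog'
  have hpos : 0 < 16 * Real.pi ^ 2 * B := by positivity
  refine ⟨?_, by linarith, by linarith⟩
  rw [mul_assoc, one_div, inv_mul_le_iff₀ (by positivity)]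
  exact hA.trans (mul_le_mul_of_nonneg_right (by linarith) ha)
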